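/- Let $H$ be a complex Hilbert space, let $\mathcal M\subseteq B(H)$ be a von Neumann algebra, and let $\mathcal M_1=\{x\in\mathcal M:\|x\|\le 1\}$ be its closed unit ball. An element $x\in\mathcal M_1$ is called a *$C^*$-extreme point* of $\mathcal M_1$ if, whenever $x=\sum_{i=1}^k t_i^*x_it_i$ with $x_1,\dots,x_k\in\mathcal M_1$ and invertible $t_1,\dots,t_k\in\mathcal M$ satisfying $\sum_{i=1}^k t_i^*t_i=\mathbf 1$, there exist unitaries $u_1,\dots,u_k\in\mathcal M$ such that $x_i=u_i^*xu_i$ for $i=1,\dots,k$. For every $x\in\mathcal M_1$ there exist $C^*$-extreme points $x_1$ and $x_2$ of $\mathcal M_1$ such that $x=\dfrac{x_1+x_2}{2}$. -/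

import Mathlib

/-- Let `A` be a unital C⋆-algebra with closed unit ball `A₁`.  An element `x ∈ A₁` is a
*C⋆-extreme point* of `A₁` if, whenever `x = ∑ tᵢ⋆ xᵢ tᵢ` is a proper C⋆-convex combination of
finitely many `xᵢ ∈ A₁` (the coefficients `tᵢ ∈ A` are invertible in `A` and `∑ tᵢ⋆ tᵢ = 1`), each
`xᵢ` is unitarily equivalent to `x` in `A`, that is, `xᵢ = uᵢ⋆ x uᵢ` for a unitary `uᵢ ∈ A`. -/
def IsCStarExtremePoint {A : Type*} [NormedRing A] [StarRing A] (x : A) : Prop :=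
  x ∈ Metric.closedBall (0 : A) 1 ∧
    ∀ (k : ℕ) (y t : Fin k → A),
      (∀ i, y i ∈ Metric.closedBall (0 : A) 1) →
      (∀ i, IsUnit (t i)) →
      ∑ i, star (t i) * t i = 1 →
      x = ∑ i, star (t i) * y i * t i →
      ∀ i, ∃ u ∈ unitary A, y i = star u * x * u

open Filter Topology

/-! ### Positivity and polar parts in C⋆-algebras. -/

section CStarAlgebra

variable {A : Type*} [CStarAlgebra A] [PartialOrder A] [StarOrderedRing A]

/-! Write `x = w|x|` with `w` a partial isometry in `M` that has no proper extension of this kind.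
Maximality forces `(1 - ww*) M (1 - w*w) = 0`; hence, with `e` the central support of `1 - w*w`, `w`
is isometric on the summand `1 - e` and coisometric on `e`. The contraction `|x|` is the mean of the
unitary `U = |x| + i√(1 - |x|²)` and its adjoint, so `x` is the mean of `wU` and `wU*`, which are of
the same type as `w`.

Operators of this type are C⋆-extreme (`isCStarExtremePoint_of_central`). Taking adjoints on the
summand `e` reduces this to an isometry `v = ∑ tᵢ* yᵢ tᵢ`. There `isometry_of_eq_sum` and
invertibility of `tᵢ` make `yᵢ` an isometry similar to `v` through `tᵢ`.

The main work is `exists_unitary_of_similar`. In terms of Wold decompositions, the similarity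
restricts to an invertible map between the unitary parts, and its inverse adjoint to one between the
defect spaces. The polar parts of these two maps, the second transported along the powers of the
isometries, add up to a unitary in `M`. -/

theorem norm_le_one_iff_star_mul_self_le_one {a : A} : ‖a‖ ≤ 1 ↔ star a * a ≤ 1 := by
  rw [← CStarAlgebra.norm_le_one_iff_of_nonneg (star a * a) (star_mul_self_nonneg a),
    CStarRing.norm_star_mul_self, ← sq, sq_le_one_iff₀ (norm_nonneg a)]

theorem IsStarProjection.norm_le_one_of_star_mul_self {p w : A} (hp : IsStarProjection p)
    (hw : star w * w = p) : ‖w‖ ≤ 1 :=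
  norm_le_one_iff_star_mul_self_le_one.2 (hw ▸ hp.le_one)

/-- An invertible positive element has a self-adjoint inverse square root. -/
theorem exists_inv_sqrt {d : A} (hd0 : 0 ≤ d) (hd : IsUnit d) :
    ∃ c : A, star c = c ∧ (∀ y, Commute d y → Commute c y) ∧ c * c * d = 1 := by
  have hdpos : IsStrictlyPositive d := ⟨hd0, hd⟩
  refine ⟨d ^ (-(1 / 2) : ℝ), CFC.rpow_nonneg.isSelfAdjoint, fun y h ↦ h.cfc_nnreal _, ?_⟩
  have h₂ := CFC.rpow_neg_mul_rpow (1 : ℝ) hdpos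
  rw [CFC.rpow_one d] at h₂
  rw [← CFC.rpow_add hd, ← h₂]
  norm_num

end CStarAlgebra

theorem mul_eq_self_of_star_mul_self {A : Type*} [CStarAlgebra A] {p w : A}
    (hp : IsStarProjection p) (hw : star w * w = p) : w * p = w := by
  have hpp := hp.isIdempotentElem.eq
  rw [← sub_eq_zero, ← CStarRing.star_mul_self_eq_zero_iff, star_sub, star_mul,
    hp.isSelfAdjoint.star_eq]
  linear_combination (norm := noncomm_ring) p * hw * p - p * hw - hw * p + hw + hpp * p - hpp

/-- If an invertible element maps the range of one projection onto the range of another,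
its polar part implements a Murray–von Neumann equivalence between them. -/
theorem exists_polar_of_invertible {A : Type*} [CStarAlgebra A] {p p' g h : A}
    (hp : IsStarProjection p) (hp' : IsStarProjection p') (hgh : g * h = 1) (hhg : h * g = 1)
    (hg : p' * g * p = g * p) (hh : p * h * p' = h * p') :
    ∃ c : A, (∀ y, Commute p y → Commute (p * star g * g * p) y → Commute c y) ∧
      star (g * p * c) * (g * p * c) = p ∧ (g * p * c) * star (g * p * c) = p' := by
  have hpp : p * p = p := hp.isIdempotentElem
  have hps : star p = p := hp.isSelfAdjoint
  have hpp' : p' * p' = p' := hp'.isIdempotentElem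
  have hps' : star p' = p' := hp'.isSelfAdjoint
  have hg2 : p * star g * p' = p * star g := by
    simpa [hps, hps', mul_assoc] using congrArg star hg
  have hh2 : p' * star h * p = p' * star h := by
    simpa [hps, hps', mul_assoc] using congrArg star hh
  have hsgh : star g * star h = 1 := by rw [← star_mul, hhg, star_one]
  have hshg : star h * star g = 1 := by rw [← star_mul, hgh, star_one]
  -- Adding `1 - p` makes the corner element `p g* g p` invertible in all of `A`, with inverse `h p'
  -- h* + (1 - p)`.
  obtain ⟨d, hd⟩ : ∃ d, d = p * star g * g * p + (1 - p) := ⟨_, rfl⟩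
  have hd0 : ∀ [PartialOrder A] [StarOrderedRing A], 0 ≤ d := by
    intros
    rw [hd]
    refine add_nonneg ?_ (sub_nonneg.2 hp.le_one)
    simpa [hps, mul_assoc] using star_mul_self_nonneg (g * p)
  clear hp hp'
  have hdp : d * p = p * star g * g * p := by
    rw [hd, add_mul, sub_mul, one_mul, hpp, sub_self, add_zero, mul_assoc _ p, hpp]
  have hpd : p * d = p * star g * g * p := by
    rw [hd, mul_add, mul_sub, mul_one, hpp, sub_self, add_zero]
    simp only [← mul_assoc, hpp]
  have hdk : d * (h * p' * star h + (1 - p)) = 1 := by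
    have h₁ : d * (h * p' * star h) = p := by
      linear_combination (norm := noncomm_ring) -d * hh * star h + hdp * (h * p' * star h)
        + p * star g * g * hh * star h + p * star g * hgh * p' * star h + hg2 * star h + p * hsgh
    rw [mul_add, h₁, mul_sub, mul_one, hdp, hd]
    abel
  have hkd : (h * p' * star h + (1 - p)) * d = 1 := by
    have h₁ : h * p' * star h * d = p := by
      linear_combination (norm := noncomm_ring) -h * hh2 * d + h * p' * star h * hpd
        + h * hh2 * (star g * g * p) + h * p' * hshg * (g * p) + h * hg + hhg * p
    rw [add_mul, h₁, sub_mul, one_mul, hpd, hd]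
    abel
  obtain ⟨c, hcs, hcomm, hccd⟩ : ∃ c : A, star c = c ∧ (∀ y, Commute d y → Commute c y) ∧
      c * c * d = 1 := by
    let _ := CStarAlgebra.spectralOrder A
    have := CStarAlgebra.spectralOrderedRing A
    exact exists_inv_sqrt hd0 ⟨⟨d, _, hdk, hkd⟩, rfl⟩
  have hcp : c * p = p * c := hcomm p (hdp.trans hpd.symm)
  have hcd : c * d = d * c := hcomm d rfl
  have hww : star (g * p * c) * (g * p * c) = p := by
    simp only [star_mul, hps, hcs]
    linear_combination (norm := noncomm_ring) -c * hpd * c + hcp * (d * c) - p * c * hcd + p * hccd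
  refine ⟨c, fun y h₁ h₂ ↦ hcomm y (hd ▸ h₂.add_left ((Commute.one_left y).sub_left h₁)), hww, ?_⟩
  -- Factoring `p'` through `g p c` shows that the final projection is all of `p'`, not just a
  -- subprojection.
  have h₁ : g * p * c * (c * d * h * p') = p' := by
    linear_combination (norm := noncomm_ring) g * p * hccd * (h * p') + g * hh + hgh * p'
  have h₂ : g * p * c * p = g * p * c := by
    linear_combination (norm := noncomm_ring) g * p * hcp + g * hpp * c
  have h₃ : star (g * p * c) * p' = star (g * p * c) := by
    rw [← hps', ← star_mul, ← mul_assoc, ← mul_assoc, hg]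
  rw [← h₃, ← mul_assoc]
  nth_rw 1 [← h₁]
  rw [mul_assoc _ (star _), ← mul_assoc (star _), hww, ← mul_assoc, h₂, h₁]

/-! ### Strong operator limits. -/

section StrongLimits

variable {H : Type*} [NormedAddCommGroup H] [InnerProductSpace ℂ H]

/-- Convergence of bounded operators in the strong operator topology. -/
def StrongTendsto {ι : Type*} (a : ι → H →L[ℂ] H) (l : Filter ι) (L : H →L[ℂ] H) : Prop :=
  ∀ h, Tendsto (fun i ↦ a i h) l (𝓝 (L h))

namespace StrongTendsto

variable {ι : Type*} {l : Filter ι} {a b : ι → H →L[ℂ] H} {L K : H →L[ℂ] H}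

theorem unique [l.NeBot] (ha : StrongTendsto a l L) (hb : StrongTendsto a l K) : L = K := by
  ext h
  exact tendsto_nhds_unique (ha h) (hb h)

theorem const (L : H →L[ℂ] H) : StrongTendsto (fun _ : ι ↦ L) l L := fun _ ↦ tendsto_const_nhds

theorem add (ha : StrongTendsto a l L) (hb : StrongTendsto b l K) :
    StrongTendsto (fun i ↦ a i + b i) l (L + K) := fun h ↦ (ha h).add (hb h)

theorem sub (ha : StrongTendsto a l L) (hb : StrongTendsto b l K) :
    StrongTendsto (fun i ↦ a i - b i) l (L - K) := fun h ↦ (ha h).sub (hb h)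

theorem const_mul (c : H →L[ℂ] H) (ha : StrongTendsto a l L) :
    StrongTendsto (fun i ↦ c * a i) l (c * L) :=
  fun h ↦ (c.continuous.tendsto _).comp (ha h)

theorem mul_const (ha : StrongTendsto a l L) (c : H →L[ℂ] H) :
    StrongTendsto (fun i ↦ a i * c) l (L * c) := fun h ↦ ha (c h)

theorem mul (ha : StrongTendsto a l L) (hb : StrongTendsto b l K) (hbd : ∀ i, ‖a i‖ ≤ 1) :
    StrongTendsto (fun i ↦ a i * b i) l (L * K) := by
  intro h
  have h₁ : Tendsto (fun i ↦ a i (b i h - K h)) l (𝓝 0) := by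
    refine squeeze_zero_norm (fun i ↦ (a i).le_of_opNorm_le (hbd i) _) ?_
    have := ((hb h).sub_const (K h)).norm
    simpa using this
  simpa using h₁.add (ha (K h))

theorem comp {κ : Type*} {m : Filter κ} (ha : StrongTendsto a l L) {f : κ → ι}
    (hf : Tendsto f m l) : StrongTendsto (fun k ↦ a (f k)) m L := fun h ↦ (ha h).comp hf

variable [CompleteSpace H]

/-- The adjoint is not strongly continuous, so convergence of the adjoints has to be assumed; inner
products then identify the limit. -/
theorem star_eq [l.NeBot] (ha : StrongTendsto a l L) (hb : StrongTendsto (fun i ↦ star (a i)) l K) :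
    star L = K := by
  ext h
  refine ext_inner_left ℂ fun k ↦ ?_
  have h₁ := (ha k).inner (𝕜 := ℂ) (tendsto_const_nhds (x := h))
  have h₂ := (tendsto_const_nhds (x := k)).inner (𝕜 := ℂ) (hb h)
  have h₃ := tendsto_nhds_unique h₁ (by
    simpa [ContinuousLinearMap.star_eq_adjoint, ContinuousLinearMap.adjoint_inner_right] using h₂)
  rw [← h₃, ContinuousLinearMap.star_eq_adjoint, ContinuousLinearMap.adjoint_inner_right]

theorem mem {M : VonNeumannAlgebra H} [l.NeBot] (ha : StrongTendsto a l L) (hM : ∀ i, a i ∈ M) :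
    L ∈ M := by
  rw [← M.commutant_commutant, VonNeumannAlgebra.mem_commutant_iff]
  intro y hy
  rw [VonNeumannAlgebra.mem_commutant_iff] at hy
  refine (ha.const_mul y).unique ?_
  simpa only [hy _ (hM _)] using ha.mul_const y

end StrongTendsto

variable [CompleteSpace H]

/-- An increasing family of contractions converges in the strong operator topology. -/
theorem exists_strongTendsto {ι : Type*} [Preorder ι] [IsDirectedOrder ι] [Nonempty ι]
    {a : ι → H →L[ℂ] H} (ha : ∀ i, ‖a i‖ ≤ 1)
    (h : ∀ i j, i ≤ j → star (a i) * a j = star (a i) * a i) :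
    ∃ L, StrongTendsto a atTop L := by
  have hsub' : ∀ i j, i ≤ j →
      star (a j - a i) * (a j - a i) = star (a j) * a j - star (a i) * a i := by
    intro i j hij
    have h₁ := h i j hij
    have h₂ := congrArg star h₁
    simp only [star_mul, star_star] at h₂
    rw [star_sub]
    linear_combination (norm := noncomm_ring) -h₁ - h₂
  have hlim : ∀ k, ∃ y, Tendsto (fun i ↦ a i k) atTop (𝓝 y) := by
    intro k
    -- Squared distances between the vectors `a i k` are increments of `g`, which is monotone and
    -- bounded; so the net is Cauchy.
    set g : ι → ℝ := fun i ↦ (inner ℂ ((star (a i) * a i) k) k).re with hg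
    have hsub : ∀ i j, i ≤ j → ‖a j k - a i k‖ ^ 2 = g j - g i := by
      intro i j hij
      have : inner ℂ ((star (a j - a i) * (a j - a i)) k) k = inner ℂ ((star (a j) * a j - star (a i) * a i) k) k := by
        rw [hsub' i j hij]
      have := congrArg Complex.re this
      rw [ContinuousLinearMap.star_eq_adjoint, mul_apply_eq_comp,
        ContinuousLinearMap.adjoint_inner_left] at this
      rw [← Complex.sub_re, ← inner_sub_left, ← sub_apply,
        ← sub_apply, ← this]
      exact norm_sq_eq_re_inner (𝕜 := ℂ) _
    have hmono : Monotone g := fun i j hij ↦ by nlinarith [hsub i j hij, sq_nonneg ‖a j k - a i k‖]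
    have hbdd : BddAbove (Set.range g) := by
      refine ⟨‖k‖ ^ 2, ?_⟩
      rintro _ ⟨i, rfl⟩
      have := ((ContinuousLinearMap.le_def _ _).1 (norm_le_one_iff_star_mul_self_le_one.1 (ha i))).re_inner_nonneg_left k
      rw [sub_apply, one_apply_eq_self, inner_sub_left, map_sub, ← norm_sq_eq_re_inner] at this
      exact sub_nonneg.1 this
    have hgl := tendsto_atTop_ciSup hmono hbdd
    refine cauchy_map_iff_exists_tendsto.1 ?_
    rw [Metric.cauchy_iff]
    refine ⟨inferInstance, fun ε hε ↦ ?_⟩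
    obtain ⟨N, hN⟩ := (hgl.eventually (lt_mem_nhds (sub_lt_self _ (by positivity : 0 < (ε / 2) ^ 2)))).exists
    refine ⟨_, image_mem_map (Ici_mem_atTop N), ?_⟩
    have key : ∀ i, N ≤ i → dist (a i k) (a N k) < ε / 2 := by
      intro i hi
      rw [dist_eq_norm]
      refine lt_of_pow_lt_pow_left₀ 2 (by positivity) ?_
      rw [hsub N i hi]
      have := le_ciSup hbdd i
      linarith
    rintro _ ⟨i, hi, rfl⟩ _ ⟨j, hj, rfl⟩
    calc dist (a i k) (a j k) ≤ _ := dist_triangle_right _ _ (a N k)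
      _ < ε := by linarith [key i hi, key j hj]
  choose f hf using hlim
  refine ⟨LinearMap.mkContinuous (linearMapOfTendsto (l := atTop) f (fun i ↦ (a i : H →ₗ[ℂ] H))
    (tendsto_pi_nhds.2 hf)) 1 fun k ↦ ?_, hf⟩
  exact le_of_tendsto (hf k).norm (Eventually.of_forall fun i ↦ (a i).le_of_opNorm_le (ha i) k)

end StrongLimits

/-! ### Wold decomposition and similarity of isometries. -/

section Wold

theorem star_pow_mul_pow_add {A : Type*} [Ring A] [StarRing A] {v : A} (hv : star v * v = 1)
    (m k : ℕ) : star v ^ m * v ^ (m + k) = v ^ k := by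
  rw [pow_add, ← mul_assoc, pow_mul_pow_eq_one m hv, one_mul]

/-- The partial sums `u n = w + ∑ k < n, x ^ k * s * star v ^ k`, given by their recursion,
have the inner products expected from an orthogonal series. -/
theorem star_mul_of_recursion {A : Type*} [Ring A] [StarRing A] {v x w s q : A} {u : ℕ → A}
    (hu₀ : u 0 = w) (hu : ∀ n, u (n + 1) = x * u n * star v + s) (hx : star x * x = 1)
    (hw : star w * w = q) (hs : star s * s = 1 - v * star v) (hsx : star s * x = 0)
    (hws : star w * s = 0) (hwx : star w * x = v * star w) (hq : v * q * star v = q) (m k : ℕ) :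
    star (u m) * u (m + k) = q + 1 - v ^ m * star v ^ m := by
  have hxs : star x * s = 0 := by simpa using congrArg star hsx
  induction m with
  | zero =>
    rw [hu₀, zero_add, pow_zero, pow_zero, mul_one, add_sub_cancel_right]
    induction k with
    | zero => rw [hu₀, hw]
    | succ k ih =>
      rw [hu]
      linear_combination (norm := noncomm_ring) hws + hwx * u k * star v + v * ih * star v + hq
  | succ m ih =>
    rw [show m + 1 + k = (m + k) + 1 by omega, hu, hu, pow_succ', pow_succ]
    simp only [star_add, star_mul, star_star]
    linear_combination (norm := noncomm_ring) hs + hsx * (u (m + k) * star v) +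
      v * star (u m) * hxs + v * star (u m) * hx * u (m + k) * star v + v * ih * star v + hq

variable {H : Type*} [NormedAddCommGroup H] [InnerProductSpace ℂ H] [CompleteSpace H]

theorem isStarProjection_pow_mul_star_pow {A : Type*} [Ring A] [StarRing A] {v : A}
    (hv : star v * v = 1) (n : ℕ) : IsStarProjection (v ^ n * star v ^ n) := by
  refine ⟨?_, by simp [IsSelfAdjoint, star_pow]⟩
  rw [IsIdempotentElem, mul_assoc, ← mul_assoc (star v ^ n), pow_mul_pow_eq_one n hv, one_mul]

/-- The projection onto the unitary part of an isometry. -/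
theorem exists_unitary_part {v : H →L[ℂ] H} (hv : star v * v = 1) :
    ∃ q, IsStarProjection q ∧ StrongTendsto (fun n : ℕ ↦ v ^ n * star v ^ n) atTop q ∧
      v * q * star v = q := by
  have hQ := isStarProjection_pow_mul_star_pow hv
  have hQ' : ∀ n : ℕ, IsStarProjection (1 - v ^ n * star v ^ n) := fun n ↦ (hQ n).one_sub
  have hQ₁ : ∀ n : ℕ, ‖v ^ n * star v ^ n‖ ≤ 1 := fun n ↦ (hQ n).norm_le
  -- The range projections decrease, so the convergence criterion is applied to their complements.
  obtain ⟨q', hq'⟩ := exists_strongTendsto (fun n ↦ (hQ' n).norm_le) (by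
    intro m n hmn
    obtain ⟨k, rfl⟩ := Nat.exists_eq_add_of_le hmn
    have h₁ : v ^ m * star v ^ m * (v ^ (m + k) * star v ^ (m + k)) =
        v ^ (m + k) * star v ^ (m + k) := by
      rw [mul_assoc, ← mul_assoc (star v ^ m), star_pow_mul_pow_add hv, ← mul_assoc, ← pow_add]
    rw [(hQ' m).isSelfAdjoint.star_eq, (hQ' m).isIdempotentElem.eq]
    linear_combination (norm := noncomm_ring) h₁)
  have hq : StrongTendsto (fun n : ℕ ↦ v ^ n * star v ^ n) atTop (1 - q') := by
    simpa using (StrongTendsto.const 1).sub hq'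
  refine ⟨1 - q', ⟨?_, ?_⟩, hq, ?_⟩
  · refine (hq.mul hq hQ₁).unique ?_
    simpa only [(hQ _).isIdempotentElem.eq] using hq
  · refine hq.star_eq ?_
    simpa only [(hQ _).isSelfAdjoint.star_eq] using hq
  · refine ((hq.const_mul v).mul_const (star v)).unique ?_
    convert hq.comp (tendsto_add_atTop_nat 1) using 2 with n
    simp only [pow_succ' v, pow_succ (star v), mul_assoc]

theorem pow_mul_mul_star_pow {A : Type*} [Ring A] [StarRing A] {v q : A}
    (hq : v * q * star v = q) (n : ℕ) : v ^ n * q * star v ^ n = q := by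
  induction n with
  | zero => simp
  | succ n ih =>
    rw [pow_succ, pow_succ']
    linear_combination (norm := noncomm_ring) v ^ n * hq * star v ^ n + ih

theorem le_pow_mul_star_pow {v q : H →L[ℂ] H} (hq : IsStarProjection q)
    (hvq : v * q * star v = q) (n : ℕ) : q ≤ v ^ n * star v ^ n := by
  have h := star_right_conjugate_nonneg hq.one_sub.nonneg (v ^ n)
  have h₁ := pow_mul_mul_star_pow hvq n
  rw [← sub_nonneg]
  convert h using 1
  rw [star_pow]
  linear_combination (norm := noncomm_ring) h₁

/-- Since `t vⁿ = xⁿ t`, the range of `vⁿ` is carried into that of `xⁿ` for every `n`; let `n` tend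
to infinity. -/
theorem unitary_part_mul_of_intertwines {v x t q r : H →L[ℂ] H} (hx : star x * x = 1)
    (hvx : x * t = t * v) (hq : StrongTendsto (fun n : ℕ ↦ v ^ n * star v ^ n) atTop q)
    (hr : StrongTendsto (fun n : ℕ ↦ x ^ n * star x ^ n) atTop r) : r * t * q = t * q := by
  have h := hr.mul (hq.const_mul t) fun n ↦ (isStarProjection_pow_mul_star_pow hx n).norm_le
  rw [mul_assoc]
  refine h.unique ?_
  convert hq.const_mul t using 2 with n
  have h₁ : t * v ^ n = x ^ n * t := (show SemiconjBy t v x from hvx.symm).pow_right n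
  have h₂ : star x ^ n * x ^ n = 1 := pow_mul_pow_eq_one n hx
  linear_combination (norm := noncomm_ring) x ^ n * star x ^ n * h₁ * star v ^ n
    + x ^ n * h₂ * t * star v ^ n - h₁ * star v ^ n

namespace VonNeumannAlgebra

theorem mem_of_forall_commute {M : VonNeumannAlgebra H} {c : H →L[ℂ] H}
    (h : ∀ y ∈ M.commutant, Commute c y) : c ∈ M := by
  rw [← M.commutant_commutant, mem_commutant_iff]
  exact fun y hy ↦ (h y hy).eq.symm

theorem commute_of_mem {M : VonNeumannAlgebra H} {c y : H →L[ℂ] H} (hc : c ∈ M)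
    (hy : y ∈ M.commutant) : Commute c y :=
  mem_commutant_iff.1 hy c hc

end VonNeumannAlgebra

open VonNeumannAlgebra in
/-- If an invertible element of a von Neumann algebra maps the range of one projection onto the
range of another, its polar part is a partial isometry between them. -/
theorem exists_polar_mem {M : VonNeumannAlgebra H} {p p' g h : H →L[ℂ] H} (hpM : p ∈ M)
    (hgM : g ∈ M) (hp : IsStarProjection p)
    (hp' : IsStarProjection p') (hgh : g * h = 1) (hhg : h * g = 1)
    (hg : p' * g * p = g * p) (hh : p * h * p' = h * p') :
    ∃ c ∈ M, (∀ y, Commute p y → Commute (p * star g * g * p) y → Commute c y) ∧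
      star (g * p * c) * (g * p * c) = p ∧ (g * p * c) * star (g * p * c) = p' := by
  obtain ⟨c, hc, hw, hw'⟩ := exists_polar_of_invertible hp hp' hgh hhg hg hh
  refine ⟨c, mem_of_forall_commute fun y hy ↦ hc y (commute_of_mem hpM hy) (commute_of_mem ?_ hy),
    hc, hw, hw'⟩
  exact mul_mem (mul_mem (mul_mem hpM (star_mem hgM)) hgM) hpM

theorem isStarProjection_one_sub_mul_star {A : Type*} [Ring A] [StarRing A] {v : A}
    (hv : star v * v = 1) : IsStarProjection (1 - v * star v) := by
  simpa using (isStarProjection_pow_mul_star_pow hv 1).one_sub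

/-- Similar isometries in a von Neumann algebra are unitarily equivalent. -/
theorem exists_unitary_of_similar {M : VonNeumannAlgebra H} {v x t t' : H →L[ℂ] H}
    (hvM : v ∈ M) (hxM : x ∈ M) (htM : t ∈ M) (htM' : t' ∈ M) (htt : t * t' = 1) (htt' : t' * t = 1)
    (hv : star v * v = 1) (hx : star x * x = 1) (hvx : x * t = t * v) :
    ∃ u ∈ M, star u * u = 1 ∧ u * star u = 1 ∧ u * v = x * u := by
  have hvx' : v * t' = t' * x := by
    linear_combination (norm := noncomm_ring) -t' * hvx * t' + t' * x * htt - htt' * v * t'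
  have hvxs : star t * star x = star v * star t := by simpa using congrArg star hvx
  have hvxs' : star t' * star v = star x * star t' := by simpa using congrArg star hvx'
  obtain ⟨q, hq, hqlim, hvqv⟩ := exists_unitary_part hv
  obtain ⟨r, hr, hrlim, hxrx⟩ := exists_unitary_part hx
  have hqM : q ∈ M := hqlim.mem fun n ↦ mul_mem (pow_mem hvM n) (pow_mem (star_mem hvM) n)
  have hvq : v * q = q * v := by
    linear_combination (norm := noncomm_ring) hvqv * v - v * q * hv
  have hxr : x * r = r * x := by
    linear_combination (norm := noncomm_ring) hxrx * x - x * r * hx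
  have hqp : q * (1 - v * star v) = 0 := by
    linear_combination (norm := noncomm_ring) hvq * star v - hvqv
  have hrp : r * (1 - x * star x) = 0 := by
    linear_combination (norm := noncomm_ring) hxr * star x - hxrx
  -- the unitary parts
  obtain ⟨c, hcM, hc, hww, hww'⟩ := exists_polar_mem hqM htM hq hr htt htt'
    (unitary_part_mul_of_intertwines hx hvx hqlim hrlim)
    (unitary_part_mul_of_intertwines hv hvx' hrlim hqlim)
  have hcv : c * v = v * c := by
    refine hc v hvq.symm ?_
    -- As `x` is isometric, `t*t` is invariant under `v* · v`. On the range of `q`, where `v` is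
    -- unitary, invariance becomes commutation.
    have ha : star v * (star t * t) * v = star t * t := by
      linear_combination (norm := noncomm_ring) -hvxs * (t * v) - star t * star x * hvx
        + star t * hx * t
    rw [commute_iff_eq]
    linear_combination (norm := noncomm_ring) -q * (star t * t) * hvq + v * q * ha * q
      - hvqv * (star t * t * v * q)
  have hwM : t * q * c ∈ M := mul_mem (mul_mem htM hqM) hcM
  have hwv : t * q * c * v = x * (t * q * c) := by
    linear_combination (norm := noncomm_ring) t * q * hcv - t * hvq * c - hvx * q * c
  generalize t * q * c = w at hww hww' hwM hwv
  have hwq : w * q = w := mul_eq_self_of_star_mul_self hq hww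
  have hWr : star w * r = star w :=
    mul_eq_self_of_star_mul_self hr (by rwa [star_star])
  have hqW : q * star w = star w := by simpa [hq.isSelfAdjoint.star_eq] using congrArg star hwq
  have hWx : star w * x = v * star w := by
    linear_combination (norm := noncomm_ring) -hWr * x - star w * hxr - star w * x * hww'
      - star w * hwv * star w + hww * v * star w - hvq * star w + v * hqW
  -- the defect spaces
  have hp := isStarProjection_one_sub_mul_star hv
  have hp' := isStarProjection_one_sub_mul_star hx
  have hpM : 1 - v * star v ∈ M := sub_mem (one_mem M) (mul_mem hvM (star_mem hvM))
  -- The adjoint of `v t' = t' x` shows that `t'*` maps `ker v*` into `ker x*`, and `t*` maps back.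
  -- No intertwining is needed on the defect spaces.
  obtain ⟨c', hcM', -, hss, hss'⟩ := exists_polar_mem (g := star t') (h := star t) hpM
    (star_mem htM') hp hp' (by rw [← star_mul, htt, star_one]) (by rw [← star_mul, htt', star_one])
    (by linear_combination (norm := noncomm_ring) x * hvxs' * (1 - v * star v)
          + x * star t' * hv * star v)
    (by linear_combination (norm := noncomm_ring) v * hvxs * (1 - x * star x)
          + v * star t * hx * star x)
  have hsM : star t' * (1 - v * star v) * c' ∈ M := mul_mem (mul_mem (star_mem htM') hpM) hcM'
  generalize star t' * (1 - v * star v) * c' = s at hss hss' hsM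
  have hsp : s * (1 - v * star v) = s := mul_eq_self_of_star_mul_self hp hss
  have hSp : star s * (1 - x * star x) = star s :=
    mul_eq_self_of_star_mul_self hp' (by rwa [star_star])
  have hpS : (1 - v * star v) * star s = star s := by
    simpa only [star_mul, hp.isSelfAdjoint.star_eq] using congrArg star hsp
  have hps : (1 - x * star x) * s = s := by
    simpa only [star_mul, hp'.isSelfAdjoint.star_eq, star_star] using congrArg star hSp
  have hSx : star s * x = 0 := by
    linear_combination (norm := noncomm_ring) -hSp * x - star s * x * hx
  have hsv : s * v = 0 := by
    linear_combination (norm := noncomm_ring) -hsp * v - s * v * hv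
  have hWs : star w * s = 0 := by
    linear_combination (norm := noncomm_ring) -hWr * s - star w * r * hps + star w * hrp * s
  have hwS : w * star s = 0 := by
    linear_combination (norm := noncomm_ring) -hwq * star s - w * q * hpS + w * hqp * star s
  -- summation
  obtain ⟨u, hu₀, hu⟩ : ∃ u : ℕ → H →L[ℂ] H, u 0 = w ∧ ∀ n, u (n + 1) = x * u n * star v + s :=
    ⟨fun n ↦ Nat.rec w (fun _ a ↦ x * a * star v + s) n, rfl, fun _ ↦ rfl⟩
  have huM : ∀ n, u n ∈ M := by
    intro n
    induction n with
    | zero => rwa [hu₀]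
    | succ n ih => rw [hu]; exact add_mem (mul_mem (mul_mem hxM ih) (star_mem hvM)) hsM
  have h₁ := star_mul_of_recursion hu₀ hu hx hww hss hSx hWs hWx hvqv
  -- The adjoints obey the same recursion with `v` and `x` exchanged, so they converge strongly too.
  have h₂ := star_mul_of_recursion (u := fun n ↦ star (u n)) (congrArg star hu₀)
    (fun n ↦ by rw [hu, star_add, star_mul, star_mul, star_star, mul_assoc]) hv
    (by rwa [star_star]) (by rwa [star_star]) (by rwa [star_star]) (by rwa [star_star])
    (by rwa [star_star]) hxrx
  have hu₁ : ∀ n, ‖u n‖ ≤ 1 := by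
    intro n
    rw [norm_le_one_iff_star_mul_self_le_one]
    refine (h₁ n 0).trans_le ?_
    rw [add_sub_right_comm, add_le_iff_nonpos_left, sub_nonpos]
    exact le_pow_mul_star_pow hq hvqv n
  have hu₁' : ∀ n, ‖star (u n)‖ ≤ 1 := fun n ↦ by rw [norm_star]; exact hu₁ n
  obtain ⟨L, hL⟩ := exists_strongTendsto hu₁ fun m n hmn ↦ by
    obtain ⟨k, rfl⟩ := Nat.exists_eq_add_of_le hmn
    exact (h₁ m k).trans (h₁ m 0).symm
  obtain ⟨L', hL'⟩ := exists_strongTendsto hu₁' fun m n hmn ↦ by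
    obtain ⟨k, rfl⟩ := Nat.exists_eq_add_of_le hmn
    exact (h₂ m k).trans (h₂ m 0).symm
  obtain rfl := hL.star_eq hL'
  refine ⟨L, hL.mem huM, ?_, ?_, ?_⟩
  · refine (hL'.mul hL hu₁').unique ?_
    convert ((StrongTendsto.const q).add (StrongTendsto.const 1)).sub hqlim using 2 with n
    · exact h₁ n 0
    · abel
  · refine (hL.mul hL' hu₁).unique ?_
    convert ((StrongTendsto.const r).add (StrongTendsto.const 1)).sub hrlim using 2 with n
    · simpa using h₂ n 0
    · abel
  -- The relation holds with a shift, `u (n + 1) v = x u n`, which disappears in the limit.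
  · refine ((hL.comp (tendsto_add_atTop_nat 1)).mul_const v).unique ?_
    convert hL.const_mul x using 2 with n
    rw [hu]
    linear_combination (norm := noncomm_ring) x * u n * hv + hsv

end Wold

/-! ### Polar decomposition and its maximal extensions. -/

section PolarDecomposition

/-- Taking adjoints in `d a = 0` gives `a d* = 0`, so the kernel condition yields `d d* = 0`. This
serves as uniqueness for polar parts. -/
theorem eq_zero_of_mul_eq_zero {A : Type*} [CStarAlgebra A] {a d : A} (ha : star a = a)
    (hda : d * a = 0) (h : ∀ c, a * c = 0 → d * c = 0) : d = 0 := by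
  have h₁ : a * star d = 0 := by simpa [ha] using congrArg star hda
  exact CStarRing.mul_star_self_eq_zero_iff d |>.1 (h _ h₁)

variable {H : Type*} [NormedAddCommGroup H] [InnerProductSpace ℂ H] [CompleteSpace H]

open ContinuousLinearMap in
theorem norm_cfcAbs_apply (y : H →L[ℂ] H) (h : H) : ‖CFC.abs y h‖ = ‖y h‖ := by
  have h₁ : adjoint (CFC.abs y) (CFC.abs y h) = adjoint y (y h) := by
    have := CFC.abs_mul_abs y
    rw [← (CFC.abs_nonneg y).isSelfAdjoint.star_eq] at this
    nth_rw 2 [(CFC.abs_nonneg y).isSelfAdjoint.star_eq] at this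
    exact congrArg (fun T : H →L[ℂ] H ↦ T h) this
  rw [← sq_eq_sq₀ (norm_nonneg _) (norm_nonneg _), apply_norm_sq_eq_inner_adjoint_left (𝕜 := ℂ),
    apply_norm_sq_eq_inner_adjoint_left (𝕜 := ℂ), comp_apply, comp_apply, h₁]

open ContinuousLinearMap in
/-- The polar decomposition of a bounded operator. -/
theorem exists_polar_decomposition (y : H →L[ℂ] H) :
    ∃ v : H →L[ℂ] H, IsStarProjection (star v * v) ∧ v * CFC.abs y = y ∧
      ∀ c, CFC.abs y * c = 0 → v * c = 0 := by
  set a := CFC.abs y with ha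
  have has : adjoint a = a := (CFC.abs_nonneg y).isSelfAdjoint.star_eq
  set K := (LinearMap.range (a : H →ₗ[ℂ] H)).topologicalClosure with hK
  have haK : ∀ h, a h ∈ K := fun h ↦
    Submodule.le_topologicalClosure _ (LinearMap.mem_range_self (a : H →ₗ[ℂ] H) h)
  let e : H →ₗ[ℂ] K := (a : H →ₗ[ℂ] H).codRestrict K haK
  have hdense : DenseRange e := by
    intro z
    rw [closure_subtype]
    have : (Subtype.val '' Set.range e) = Set.range a := by
      rw [← Set.range_comp]; rfl
    rw [this]
    exact z.2
  have hnorm : ∀ h, ‖(y : H →ₗ[ℂ] H) h‖ ≤ 1 * ‖e h‖ := fun h ↦ by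
    rw [one_mul]
    exact (norm_cfcAbs_apply y h).ge
  -- The isometric map `|y| h ↦ y h` extends to the closure of the range of `|y|`.
  set V := (y : H →ₗ[ℂ] H).extendOfNorm e with hV
  have hVe : ∀ h, V (e h) = y h := LinearMap.extendOfNorm_eq hdense ⟨1, hnorm⟩
  have hVn : ∀ z, ‖V z‖ = ‖z‖ := by
    intro z
    refine hdense.induction_on (p := fun z ↦ ‖V z‖ = ‖z‖) z
      (isClosed_eq (by fun_prop) (by fun_prop)) fun h ↦ ?_
    rw [hVe]
    exact (norm_cfcAbs_apply y h).symm
  have hVV := (norm_map_iff_adjoint_comp_self V).1 hVn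
  refine ⟨V ∘L K.orthogonalProjectionOnto, ?_, ?_, ?_⟩
  · have : star (V ∘L K.orthogonalProjectionOnto) * (V ∘L K.orthogonalProjectionOnto) =
        K.starProjection := by
      rw [star_eq_adjoint, adjoint_comp, mul_def, comp_assoc, ← comp_assoc _ V, hVV,
        Submodule.adjoint_orthogonalProjectionOnto]
      rfl
    rw [this]
    exact isStarProjection_starProjection
  · ext h
    have : K.orthogonalProjectionOnto (a h) = e h :=
      K.orthogonalProjectionOnto_mem_subspace_eq_self (e h)
    simp [this, hVe]
  · intro c hc
    ext h
    have : K.orthogonalProjectionOnto (c h) = 0 := by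
      rw [Submodule.orthogonalProjectionOnto_eq_zero_iff, hK, Submodule.orthogonal_closure]
      rintro _ ⟨k, rfl⟩
      have : a (c h) = 0 := congrArg (fun T : H →L[ℂ] H ↦ T h) hc
      change inner ℂ (a k) (c h) = 0
      rw [← adjoint_inner_right, has, this, inner_zero_right]
    simp [this]

open VonNeumannAlgebra in
theorem exists_polar_decomposition_mem {M : VonNeumannAlgebra H} {y : H →L[ℂ] H} (hy : y ∈ M) :
    ∃ v ∈ M, IsStarProjection (star v * v) ∧ v * CFC.abs y = y ∧
      ∀ c, CFC.abs y * c = 0 → v * c = 0 := by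
  obtain ⟨v, hv, hvy, hker⟩ := exists_polar_decomposition y
  refine ⟨v, mem_of_forall_commute fun b hb ↦ ?_, hv, hvy, hker⟩
  have hab : CFC.abs y * b = b * CFC.abs y :=
    (Commute.cfcAbs_left (commute_of_mem hy hb) (commute_of_mem hy (star_mem hb))).eq
  have hyb : y * b = b * y := commute_of_mem hy hb
  -- The commutator `v b - b v` vanishes on the range and on the kernel of `|y|`.
  refine sub_eq_zero.1 (eq_zero_of_mul_eq_zero (CFC.abs_nonneg y).isSelfAdjoint.star_eq ?_ ?_)
  · linear_combination (norm := noncomm_ring) -v * hab + hvy * b - b * hvy + hyb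
  · intro c hc
    have h₁ := hker (b * c) (by linear_combination (norm := noncomm_ring) hab * c + b * hc)
    linear_combination (norm := noncomm_ring) h₁ - b * hker c hc

/-- With `p = w*w` and `p' = w'*w'`, the extension property gives `p p' p = p`, hence `(p' p -
p)*(p' p - p) = 0`. -/
theorem mul_eq_of_extends {A : Type*} [CStarAlgebra A] {w w' : A}
    (hw : IsStarProjection (star w * w)) (hw' : IsStarProjection (star w' * w'))
    (h : w' * (star w * w) = w) : star w' * w' * (star w * w) = star w * w := by
  have hs : star w * w * star w' = star w := by simpa [mul_assoc] using congrArg star h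
  have hp := hw.isIdempotentElem.eq
  have hp' := hw'.isIdempotentElem.eq
  generalize hP : star w * w = p at *
  generalize hP' : star w' * w' = p' at *
  have hps : star p = p := hw.isSelfAdjoint.star_eq
  have hps' : star p' = p' := hw'.isSelfAdjoint.star_eq
  have hppp : p * p' * p = p := by
    rw [← hP', ← hP] at *
    linear_combination (norm := noncomm_ring) star w * w * star w' * h + hs * w
  rw [← sub_eq_zero, ← CStarRing.star_mul_self_eq_zero_iff, star_sub, star_mul, hps, hps']
  linear_combination (norm := noncomm_ring) p * hp' * p - hppp + hp

/-- A chain of partial isometries, ordered by extension, has an upper bound. -/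
theorem exists_common_extension {ι : Type*} [Nonempty ι] {w : ι → H →L[ℂ] H}
    (hw : ∀ i, IsStarProjection (star (w i) * w i))
    (hchain : ∀ i j, w j * (star (w i) * w i) = w i ∨ w i * (star (w j) * w j) = w j) :
    ∃ L, IsStarProjection (star L * L) ∧ (∀ i, L * (star (w i) * w i) = w i) ∧
      (∀ M : VonNeumannAlgebra H, (∀ i, w i ∈ M) → L ∈ M) ∧
      ∀ b c, (∀ i, w i * b = c) → L * b = c := by
  let _ : Preorder ι :=
    { le := fun i j ↦ w j * (star (w i) * w i) = w i
      le_refl := fun i ↦ mul_eq_self_of_star_mul_self (hw i) rfl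
      le_trans := fun i j k (hij : w j * (star (w i) * w i) = w i)
          (hjk : w k * (star (w j) * w j) = w j) ↦ by
        have h₃ := mul_eq_of_extends (hw i) (hw j) hij
        linear_combination (norm := noncomm_ring)
          -w k * h₃ + hjk * (star (w i) * w i) + hij }
  have hle : ∀ {i j : ι}, i ≤ j → w j * (star (w i) * w i) = w i := fun h ↦ h
  have : IsDirectedOrder ι := ⟨fun i j ↦ by
    obtain h | h := hchain i j
    · exact ⟨j, h, le_rfl⟩
    · exact ⟨i, le_rfl, h⟩⟩
  have hw₁ : ∀ i, ‖w i‖ ≤ 1 := fun i ↦ (hw i).norm_le_one_of_star_mul_self rfl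
  have hmul : ∀ i j : ι, i ≤ j → star (w i) * w j = star (w i) * w i := by
    intro i j hij
    have h₁ := congrArg star (mul_eq_of_extends (hw i) (hw j) (hle hij))
    have h₂ : star (w i) * w i * star (w j) = star (w i) := by
      simpa [mul_assoc] using congrArg star (hle hij)
    simp only [star_mul, star_star] at h₁
    rw [← h₁, ← mul_assoc, h₂]
  obtain ⟨L, hL⟩ := exists_strongTendsto hw₁ hmul
  have hLw : ∀ i, L * (star (w i) * w i) = w i := by
    intro i
    -- On the initial space of `w i` the net is eventually constant.
    refine (hL.mul_const (star (w i) * w i)).unique fun h ↦ ?_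
    refine tendsto_const_nhds.congr' ?_
    filter_upwards [Ici_mem_atTop i] with j hij
    rw [hle hij]
  have hwL : ∀ i, star (w i) * L = star (w i) * w i := by
    intro i
    refine (hL.const_mul (star (w i))).unique fun h ↦ ?_
    refine tendsto_const_nhds.congr' ?_
    filter_upwards [Ici_mem_atTop i] with j hij
    rw [hmul i j hij]
  have hLw' : ∀ i, star L * w i = star (w i) * w i := fun i ↦ by
    simpa using congrArg star (hwL i)
  have hP : StrongTendsto (fun i ↦ star (w i) * w i) atTop (star L * L) := by
    simpa only [hLw'] using hL.const_mul (star L)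
  refine ⟨L, ⟨?_, IsSelfAdjoint.star_mul_self L⟩, hLw, fun M hM ↦ hL.mem hM, fun b c h ↦ ?_⟩
  · refine (hP.mul hP fun i ↦ (hw i).norm_le).unique ?_
    simpa only [(hw _).isIdempotentElem.eq] using hP
  · refine (hL.mul_const b).unique ?_
    simpa only [h] using StrongTendsto.const c

/-- Every element of a von Neumann algebra has a polar decomposition in which the partial isometry
cannot be extended. -/
theorem exists_maximal_polar_decomposition {M : VonNeumannAlgebra H} {x : H →L[ℂ] H}
    (hx : x ∈ M) : ∃ w ∈ M, IsStarProjection (star w * w) ∧ w * CFC.abs x = x ∧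
      ∀ y ∈ M, (1 - w * star w) * y * (1 - star w * w) = 0 := by
  let S := {w : H →L[ℂ] H // w ∈ M ∧ IsStarProjection (star w * w) ∧ w * CFC.abs x = x}
  let r : S → S → Prop := fun w w' ↦ w'.1 * (star w.1 * w.1) = w.1
  have hrefl : ∀ w, r w w := fun w ↦ mul_eq_self_of_star_mul_self w.2.2.1 rfl
  -- Zorn's lemma for extension of partial isometries; the ordinary polar decomposition bounds the
  -- empty chain.
  obtain ⟨⟨w, hwM, hw, hwx⟩, hmax⟩ := exists_maximal_of_chains_bounded (r := r) (fun c hc ↦ by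
    obtain rfl | hne := c.eq_empty_or_nonempty
    · obtain ⟨v, hvM, hv, hvx, -⟩ := exists_polar_decomposition_mem hx
      exact ⟨⟨v, hvM, hv, hvx⟩, by simp⟩
    have : Nonempty c := hne.to_subtype
    obtain ⟨L, hL, hLw, hLM, hLx⟩ := exists_common_extension (w := fun i : c ↦ i.1.1)
      (fun i ↦ i.1.2.2.1) fun i j ↦ by
        by_cases hij : i = j
        · exact Or.inl (hij ▸ hrefl j)
        · exact hc i.2 j.2 (Subtype.coe_injective.ne hij)
    exact ⟨⟨L, hLM M fun i ↦ i.1.2.1, hL, hLx _ _ fun i ↦ i.1.2.2.2⟩, fun i hi ↦ hLw ⟨i, hi⟩⟩)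
    fun {w₁ w₂ w₃} (h₁ : w₂.1 * (star w₁.1 * w₁.1) = w₁.1)
        (h₂ : w₃.1 * (star w₂.1 * w₂.1) = w₂.1) ↦ by
      have h₃ := mul_eq_of_extends w₁.2.2.1 w₂.2.2.1 h₁
      change w₃.1 * (star w₁.1 * w₁.1) = w₁.1
      linear_combination (norm := noncomm_ring)
        -w₃.1 * h₃ + h₂ * (star w₁.1 * w₁.1) + h₁
  refine ⟨w, hwM, hw, hwx, fun y hy ↦ ?_⟩
  have hwp : w * (star w * w) = w := mul_eq_self_of_star_mul_self hw rfl
  have hpw : star w * w * star w = star w := by simpa [mul_assoc] using congrArg star hwp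
  set z := (1 - w * star w) * y * (1 - star w * w) with hz
  have hzM : z ∈ M := mul_mem (mul_mem (sub_mem (one_mem M) (mul_mem hwM (star_mem hwM))) hy)
    (sub_mem (one_mem M) (mul_mem (star_mem hwM) hwM))
  have hzp : z * (star w * w) = 0 := by
    rw [hz]
    linear_combination (norm := noncomm_ring) -(1 - w * star w) * y * star w * hwp
  have hwz : star w * z = 0 := by
    rw [hz]
    linear_combination (norm := noncomm_ring) -hpw * (y * (1 - star w * w))
  -- The polar part `s` of `z` has initial and final spaces orthogonal to those of `w`, so `w + s`
  -- extends `w`. Maximality will force `s = 0`, hence `z = 0`.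
  obtain ⟨s, hsM, hs, hsz, hker⟩ := exists_polar_decomposition_mem hzM
  have hab := CFC.abs_mul_abs z
  have habs : star (CFC.abs z) = CFC.abs z := (CFC.abs_nonneg z).isSelfAdjoint.star_eq
  have hsp : s * (star w * w) = 0 := by
    refine hker _ ?_
    rw [← CStarRing.star_mul_self_eq_zero_iff, star_mul, habs]
    linear_combination (norm := noncomm_ring) star (star w * w) * hab * (star w * w)
      + star (star w * w) * star z * hzp
  have hsW : s * star w = 0 := by
    linear_combination (norm := noncomm_ring) hsp * star w - s * hpw
  have hWs : star w * s = 0 := by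
    refine eq_zero_of_mul_eq_zero habs ?_ fun c hc ↦ ?_
    · rw [mul_assoc, hsz, hwz]
    · rw [mul_assoc, hker c hc, mul_zero]
  have hSw : star s * w = 0 := by simpa using congrArg star hWs
  have hwS : w * star s = 0 := by simpa using congrArg star hsW
  have hsum : star (w + s) * (w + s) = star w * w + star s * s := by
    rw [star_add]
    linear_combination (norm := noncomm_ring) hWs + hSw
  -- The range of `|x|` lies in the initial space of `w`, so `s` kills it and `w + s` still factors
  -- `x`.
  have hpabs : star w * w * CFC.abs x = CFC.abs x := by
    have hxs : star (CFC.abs x) = CFC.abs x := (CFC.abs_nonneg x).isSelfAdjoint.star_eq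
    have hxx := CFC.abs_mul_abs x
    have hwx' : CFC.abs x * star w = star x := by simpa [hxs] using congrArg star hwx
    have hxw : star x * (w * CFC.abs x) = star x * x := by rw [hwx]
    rw [← sub_eq_zero, ← CStarRing.star_mul_self_eq_zero_iff, star_sub, star_mul, star_mul,
      star_star, hxs]
    linear_combination (norm := noncomm_ring) CFC.abs x * star w * hwp * CFC.abs x
      - hwx' * (w * CFC.abs x) - hxw + hxx
  have hsx : s * CFC.abs x = 0 := by
    rw [← hpabs, ← mul_assoc, hsp, zero_mul]
  have hp : IsStarProjection (star (w + s) * (w + s)) := by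
    rw [hsum]
    refine hw.add hs ?_
    rw [mul_assoc, ← mul_assoc w, hwS, zero_mul, mul_zero]
  have h₁ := hmax ⟨w + s, add_mem hwM hsM, hp, by rw [add_mul, hwx, hsx, add_zero]⟩
    (show (w + s) * (star w * w) = w by rw [add_mul, hwp, hsp, add_zero])
  change w * (star (w + s) * (w + s)) = w + s at h₁
  rw [hsum, mul_add, hwp, ← mul_assoc, hwS, zero_mul, add_right_inj] at h₁
  rw [← hsz, ← h₁, zero_mul]

end PolarDecomposition

/-! ### Central supports. -/

section CentralSupport

variable {H : Type*} [NormedAddCommGroup H] [InnerProductSpace ℂ H] [CompleteSpace H]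

/-- The central support of a projection in a von Neumann algebra. -/
theorem exists_central_support {M : VonNeumannAlgebra H} {p : H →L[ℂ] H} (hp : p ∈ M) :
    ∃ e ∈ M, e ∈ M.commutant ∧ IsStarProjection e ∧ e * p = p ∧
      ∀ k : H →L[ℂ] H, (∀ y ∈ M, k * y * p = 0) → k * e = 0 := by
  -- The closed span of `M p H` is invariant under both `M` and its commutant, so its projection is
  -- central.
  set K₀ : Submodule ℂ H := Submodule.span ℂ {h | ∃ y ∈ M, ∃ k, h = y (p k)} with hK₀
  set K := K₀.topologicalClosure with hK
  have hmem : ∀ y ∈ M, ∀ k, y (p k) ∈ K := fun y hy k ↦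
    K₀.le_topologicalClosure (Submodule.subset_span ⟨y, hy, k, rfl⟩)
  have hle : ∀ (T : H →L[ℂ] H) (N : Submodule ℂ H), IsClosed (N : Set H) →
      (∀ y ∈ M, ∀ k, T (y (p k)) ∈ N) → ∀ h ∈ K, T h ∈ N := by
    intro T N hN h
    have : K ≤ N.comap (T : H →ₗ[ℂ] H) := by
      refine K₀.topologicalClosure_minimal (Submodule.span_le.2 ?_) (hN.preimage T.continuous)
      rintro _ ⟨y, hy, k, rfl⟩
      exact h y hy k
    exact this
  have hKc : IsClosed (K : Set H) := K₀.isClosed_topologicalClosure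
  have he : IsStarProjection K.starProjection := isStarProjection_starProjection
  have hrange : K.starProjection.range = K := K.range_starProjection
  refine ⟨K.starProjection, ?_, ?_, he, ?_, ?_⟩
  · rw [VonNeumannAlgebra.IsStarProjection.mem_iff he]
    intro b hb
    rw [Module.End.mem_invtSubmodule, hrange]
    refine hle b K hKc fun y hy k ↦ ?_
    have h₁ : b (y (p k)) = y (p (b k)) := by
      have : b * (y * p) = y * p * b :=
        (VonNeumannAlgebra.commute_of_mem (mul_mem hy hp) hb).eq.symm
      exact congrArg (fun T : H →L[ℂ] H ↦ T k) this
    rw [h₁]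
    exact hmem y hy _
  · rw [VonNeumannAlgebra.IsStarProjection.mem_iff he, M.commutant_commutant]
    intro b hb
    rw [Module.End.mem_invtSubmodule, hrange]
    exact hle b K hKc fun y hy k ↦ hmem (b * y) (mul_mem hb hy) k
  · ext h
    exact Submodule.starProjection_eq_self_iff.2 (hmem 1 (one_mem M) h)
  · intro k hk
    ext h
    have := hle k ⊥ isClosed_singleton (fun y hy h ↦ congrArg (fun T : H →L[ℂ] H ↦ T h) (hk y hy)) _
      (K.starProjection_apply_mem h)
    simpa using this

end CentralSupport

/-! ### C⋆-extremality of isometries and of central sums with coisometries. -/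

section CStarExtreme

variable {H : Type*} [NormedAddCommGroup H] [InnerProductSpace ℂ H] [CompleteSpace H]

/-- The positive elements `|yᵢ tᵢ - tᵢ v|² + tᵢ*(1 - yᵢ* yᵢ)tᵢ` sum to `1 - v*v = 0`, so every
summand vanishes. -/
theorem isometry_of_eq_sum {ι : Type*} [Fintype ι] {v : H →L[ℂ] H} {y t : ι → H →L[ℂ] H}
    (hv : star v * v = 1) (hy : ∀ i, ‖y i‖ ≤ 1) (ht : ∑ i, star (t i) * t i = 1)
    (hsum : v = ∑ i, star (t i) * y i * t i) (i : ι) :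
    y i * t i = t i * v ∧ star (t i) * (1 - star (y i) * y i) * t i = 0 := by
  have h₁ : ∀ i, 0 ≤ star (y i * t i - t i * v) * (y i * t i - t i * v) :=
    fun i ↦ star_mul_self_nonneg _
  have h₂ : ∀ i, 0 ≤ star (t i) * (1 - star (y i) * y i) * t i := fun i ↦
    star_left_conjugate_nonneg (sub_nonneg.2 (norm_le_one_iff_star_mul_self_le_one.1 (hy i))) _
  have hterm : ∀ i, star (y i * t i - t i * v) * (y i * t i - t i * v)
      + star (t i) * (1 - star (y i) * y i) * t i =
      star (t i) * t i - star (star (t i) * y i * t i) * v - star v * (star (t i) * y i * t i)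
      + star v * (star (t i) * t i) * v := by
    intro i
    simp only [star_sub, star_mul, star_star]
    noncomm_ring
  have hzero : ∑ i, (star (y i * t i - t i * v) * (y i * t i - t i * v)
      + star (t i) * (1 - star (y i) * y i) * t i) = 0 := by
    simp only [hterm, Finset.sum_add_distrib, Finset.sum_sub_distrib, ← Finset.sum_mul,
      ← Finset.mul_sum, ← star_sum, ht, ← hsum]
    linear_combination (norm := noncomm_ring) -hv
  have h₃ := (Finset.sum_eq_zero_iff_of_nonneg fun i _ ↦ add_nonneg (h₁ i) (h₂ i)).1 hzero i
    (Finset.mem_univ i)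
  obtain ⟨h₄, h₅⟩ := (add_eq_zero_iff_of_nonneg (h₁ i) (h₂ i)).1 h₃
  exact ⟨sub_eq_zero.1 (CStarRing.star_mul_self_eq_zero_iff _ |>.1 h₄), h₅⟩

/-- Isometries of a von Neumann algebra satisfy the defining property of C⋆-extreme points. -/
theorem exists_unitary_of_isometry_eq_sum {M : VonNeumannAlgebra H} {ι : Type*} [Fintype ι]
    {v : H →L[ℂ] H} {y t t' : ι → H →L[ℂ] H} (hvM : v ∈ M) (hyM : ∀ i, y i ∈ M)
    (htM : ∀ i, t i ∈ M) (htM' : ∀ i, t' i ∈ M) (htt : ∀ i, t i * t' i = 1)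
    (htt' : ∀ i, t' i * t i = 1) (hv : star v * v = 1) (hy : ∀ i, ‖y i‖ ≤ 1)
    (ht : ∑ i, star (t i) * t i = 1) (hsum : v = ∑ i, star (t i) * y i * t i) (i : ι) :
    ∃ u ∈ M, star u * u = 1 ∧ u * star u = 1 ∧ y i = star u * v * u := by
  obtain ⟨h₁, h₂⟩ := isometry_of_eq_sum hv hy ht hsum i
  have h₃ : star (t' i) * star (t i) = 1 := by rw [← star_mul, htt, star_one]
  have h₄ : star (y i) * y i = 1 := by
    linear_combination (norm := noncomm_ring) -star (t' i) * h₂ * t' i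
      + h₃ * (1 - star (y i) * y i) * t i * t' i + (1 - star (y i) * y i) * htt i
  obtain ⟨u, huM, hu, hu', huv⟩ := exists_unitary_of_similar hvM (hyM i) (htM i) (htM' i)
    (htt i) (htt' i) hv h₄ h₁
  refine ⟨star u, star_mem huM, by rwa [star_star], by rwa [star_star], ?_⟩
  rw [star_star]
  linear_combination (norm := noncomm_ring) -y i * hu' - huv * star u

/-- Replacing `v` and `yᵢ` by `z v + (1 - z)` and `z yᵢ + (1 - z)` keeps the same coefficients,
because `z` is central, and gives a global isometry. -/
theorem exists_unitary_of_corner_isometry {M : VonNeumannAlgebra H} {ι : Type*} [Fintype ι]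
    {z v : H →L[ℂ] H} {y t t' : ι → H →L[ℂ] H} (hzM : z ∈ M) (hz : IsStarProjection z)
    (hzc : ∀ a ∈ M, z * a = a * z) (hvM : v ∈ M) (hyM : ∀ i, y i ∈ M)
    (htM : ∀ i, t i ∈ M) (htM' : ∀ i, t' i ∈ M) (htt : ∀ i, t i * t' i = 1)
    (htt' : ∀ i, t' i * t i = 1) (hv : z * (star v * v) = z) (hy : ∀ i, ‖y i‖ ≤ 1)
    (ht : ∑ i, star (t i) * t i = 1) (hsum : v = ∑ i, star (t i) * y i * t i) (i : ι) :
    ∃ u ∈ M, star u * u = 1 ∧ u * star u = 1 ∧ z * y i = z * (star u * v * u) := by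
  have hzz : z * z = z := hz.isIdempotentElem.eq
  have hzs : star z = z := hz.isSelfAdjoint.star_eq
  have hcM : ∀ a ∈ M, z * a + (1 - z) ∈ M := fun a ha ↦
    add_mem (mul_mem hzM ha) (sub_mem (one_mem M) hzM)
  have hsq : ∀ a ∈ M, star (z * a + (1 - z)) * (z * a + (1 - z)) = z * (star a * a) + (1 - z) := by
    intro a ha
    have h₂ := hzc (star a) (star_mem ha)
    simp only [star_add, star_mul, star_sub, star_one, hzs]
    linear_combination (norm := noncomm_ring) star a * hzz * a - h₂ * a - star a * hzz
      - hzz * a + hzz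
  obtain ⟨u, huM, hu, hu', huv⟩ := exists_unitary_of_isometry_eq_sum
    (v := z * v + (1 - z)) (y := fun i ↦ z * y i + (1 - z)) (hcM v hvM) (fun i ↦ hcM _ (hyM i))
    htM htM' htt htt' (by rw [hsq v hvM, hv]; abel) (fun i ↦ by
      rw [norm_le_one_iff_star_mul_self_le_one, hsq _ (hyM i), ← sub_nonneg]
      have h₁ := star_left_conjugate_nonneg
        (sub_nonneg.2 (norm_le_one_iff_star_mul_self_le_one.1 (hy i))) z
      convert h₁ using 1
      rw [hzs]
      have h₂ := hzc (star (y i) * y i) (mul_mem (star_mem (hyM i)) (hyM i))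
      linear_combination (norm := noncomm_ring) hzz * (star (y i) * y i) - hzz - z * h₂)
    ht (by
      have : ∀ i, star (t i) * (z * y i + (1 - z)) * t i =
          z * (star (t i) * y i * t i) + (1 - z) * (star (t i) * t i) := fun i ↦ by
        have h₁ := hzc (star (t i)) (star_mem (htM i))
        linear_combination (norm := noncomm_ring) h₁ * t i - h₁ * (y i * t i)
      simp only [this, Finset.sum_add_distrib, ← Finset.mul_sum, ht, ← hsum, mul_one]) i
  refine ⟨u, huM, hu, hu', ?_⟩
  have h₁ := hzc (star u) (star_mem huM)
  linear_combination (norm := noncomm_ring) z * huv - hzz * y i - z * h₁ * (v * u)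
    + hzz * (star u * v * u) + z * h₁ * u - hzz * (star u * u) + hzz

/-- A contraction in a von Neumann algebra which is an isometry on one central summand and a
coisometry on the complementary one is a C⋆-extreme point of the unit ball. -/
theorem isCStarExtremePoint_of_central {M : VonNeumannAlgebra H} {z : H →L[ℂ] H} {v : M}
    (hzM : z ∈ M) (hz : IsStarProjection z) (hzc : ∀ a ∈ M, z * a = a * z)
    (hv : z * (star (v : H →L[ℂ] H) * v) = z)
    (hv' : (1 - z) * ((v : H →L[ℂ] H) * star (v : H →L[ℂ] H)) = 1 - z)
    (hv₁ : ‖(v : H →L[ℂ] H)‖ ≤ 1) : IsCStarExtremePoint v := by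
  refine ⟨mem_closedBall_zero_iff.2 hv₁, fun k y t hy ht hsum hvsum i ↦ ?_⟩
  choose T hT using ht
  have htt : ∀ i, (t i : H →L[ℂ] H) * ((T i)⁻¹ : Mˣ).1.1 = 1 := fun i ↦ by
    have := congrArg Subtype.val (T i).mul_inv
    rwa [hT] at this
  have htt' : ∀ i, ((T i)⁻¹ : Mˣ).1.1 * (t i : H →L[ℂ] H) = 1 := fun i ↦ by
    have := congrArg Subtype.val (T i).inv_mul
    rwa [hT] at this
  have hy₁ : ∀ i, ‖(y i : H →L[ℂ] H)‖ ≤ 1 := fun i ↦ mem_closedBall_zero_iff.1 (hy i)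
  have hsum₁ : ∑ i, star (t i : H →L[ℂ] H) * t i = 1 := by
    simpa using congrArg Subtype.val hsum
  have hvsum₁ : (v : H →L[ℂ] H) = ∑ i, star (t i : H →L[ℂ] H) * y i * t i := by
    simpa using congrArg Subtype.val hvsum
  obtain ⟨u₁, hu₁M, hu₁, hu₁', huv₁⟩ := exists_unitary_of_corner_isometry hzM hz hzc v.2
    (fun i ↦ (y i).2) (fun i ↦ (t i).2) (fun i ↦ ((T i)⁻¹ : Mˣ).1.2) htt htt' hv hy₁ hsum₁ hvsum₁ i
  -- On `1 - z` the adjoint of `v` is isometric and is the same combination of the adjoints of the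
  -- `y i`.
  obtain ⟨u₂, hu₂M, hu₂, hu₂', huv₂⟩ := exists_unitary_of_corner_isometry
    (sub_mem (one_mem M) hzM) hz.one_sub
    (fun a ha ↦ by rw [sub_mul, mul_sub, hzc a ha, one_mul, mul_one]) (star_mem v.2)
    (fun i ↦ star_mem (y i).2) (fun i ↦ (t i).2) (fun i ↦ ((T i)⁻¹ : Mˣ).1.2) htt htt'
    (by rwa [star_star]) (fun i ↦ by rw [norm_star]; exact hy₁ i) hsum₁
    (by rw [hvsum₁, star_sum]; simp only [star_mul, star_star, mul_assoc]) i
  have hzz : z * z = z := hz.isIdempotentElem.eq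
  have hzs : star z = z := hz.isSelfAdjoint.star_eq
  have huv₂' : (y i : H →L[ℂ] H) * (1 - z) = star u₂ * v * u₂ * (1 - z) := by
    simpa only [star_mul, star_star, star_sub, star_one, hzs, mul_assoc] using congrArg star huv₂
  have c₁ := hzc _ (star_mem hu₁M)
  have c₂ := hzc _ (star_mem hu₂M)
  have cV := hzc _ v.2
  have cY := hzc _ (y i).2
  have cG := hzc _ (mul_mem (mul_mem (star_mem hu₂M) v.2) hu₂M)
  have cD := hzc _ (mul_mem hu₁M (star_mem hu₂M))
  have cF := hzc _ (mul_mem hu₂M (star_mem hu₁M))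
  have hstar : star (z * u₁ + (1 - z) * u₂) = star u₁ * z + star u₂ * (1 - z) := by
    simp only [star_add, star_mul, star_sub, star_one, hzs]
  -- Centrality of `z` lets the unitaries of the two summands be glued.
  refine ⟨⟨z * u₁ + (1 - z) * u₂, add_mem (mul_mem hzM hu₁M)
    (mul_mem (sub_mem (one_mem M) hzM) hu₂M)⟩,
    Unitary.mem_iff.2 ⟨Subtype.ext ?_, Subtype.ext ?_⟩, Subtype.ext ?_⟩
  · change star (z * u₁ + (1 - z) * u₂) * (z * u₁ + (1 - z) * u₂) = 1
    rw [hstar]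
    linear_combination (norm := noncomm_ring) star u₁ * hzz * u₁ - c₁ * u₁ + z * hu₁
      - star u₁ * hzz * u₂ - star u₂ * hzz * u₁ + star u₂ * hzz * u₂ + hu₂ + c₂ * u₂ - z * hu₂
  · change (z * u₁ + (1 - z) * u₂) * star (z * u₁ + (1 - z) * u₂) = 1
    rw [hstar]
    linear_combination (norm := noncomm_ring) z * hu₁' * z + z * cD - hzz * (u₁ * star u₂) - cF
      + z * cF - hzz * (u₂ * star u₁) + (1 - z) * hu₂' * (1 - z) + hzz + hzz
  · change (y i : H →L[ℂ] H) =
      star (z * u₁ + (1 - z) * u₂) * v * (z * u₁ + (1 - z) * u₂)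
    rw [hstar]
    generalize (v : H →L[ℂ] H) = V at *
    generalize (y i : H →L[ℂ] H) = Y at *
    linear_combination (norm := noncomm_ring) huv₁ + huv₂' - cY + cG
      - star u₁ * hzz * V * u₁ + star u₁ * z * cV * u₁ + c₁ * (V * u₁)
      - star u₁ * z * cV * u₂ + star u₁ * hzz * V * u₂
      + star u₂ * cV * u₁ - star u₂ * z * cV * u₁ + star u₂ * hzz * V * u₁
      - star u₂ * cV * u₂ - star u₂ * hzz * V * u₂ + star u₂ * z * cV * u₂ - c₂ * (V * u₂)

end CStarExtreme

theorem corollaryc {H : Type*} [NormedAddCommGroup H] [InnerProductSpace ℂ H] [CompleteSpace H]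
    (M : VonNeumannAlgebra H) (x : M) (hx : x ∈ Metric.closedBall (0 : M) 1) :
    ∃ x₁ x₂ : M, IsCStarExtremePoint x₁ ∧ IsCStarExtremePoint x₂ ∧
      (x : H →L[ℂ] H) = (1 / 2 : ℂ) • ((x₁ : H →L[ℂ] H) + (x₂ : H →L[ℂ] H)) := by
  obtain ⟨w, hwM, hw, hwx, hmax⟩ := exists_maximal_polar_decomposition x.2
  have hpM : 1 - star w * w ∈ M := sub_mem (one_mem M) (mul_mem (star_mem hwM) hwM)
  obtain ⟨e, heM, heM', he, hep, hek⟩ := exists_central_support hpM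
  have hec : ∀ a ∈ M, (1 - e) * a = a * (1 - e) := fun a ha ↦ by
    rw [sub_mul, mul_sub, one_mul, mul_one, VonNeumannAlgebra.mem_commutant_iff.1 heM' a ha]
  -- Maximality of `w` says exactly that `1 - ww*` kills `M (1 - w*w)`, hence the central support
  -- `e`.
  have hqe := hek _ hmax
  have hzw : (1 - e) * (star w * w) = 1 - e := by
    linear_combination (norm := noncomm_ring) hep
  have hzw' : (1 - (1 - e)) * (w * star w) = 1 - (1 - e) := by
    have := VonNeumannAlgebra.mem_commutant_iff.1 heM' _ (mul_mem hwM (star_mem hwM))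
    linear_combination (norm := noncomm_ring) -hqe - this
  have hx₁ : ‖CFC.abs (x : H →L[ℂ] H)‖ ≤ 1 := by
    rw [CFC.norm_abs]
    exact mem_closedBall_zero_iff.1 hx
  have hsa : IsSelfAdjoint (CFC.abs (x : H →L[ℂ] H)) := (CFC.abs_nonneg _).isSelfAdjoint
  have hU := hsa.self_add_I_smul_cfcSqrt_sub_sq_mem_unitary _ hx₁
  set a := CFC.abs (x : H →L[ℂ] H) with ha
  set U := a + Complex.I • CFC.sqrt (1 - a ^ 2) with hUdef
  have hUM : U ∈ M := VonNeumannAlgebra.mem_of_forall_commute fun b hb ↦ by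
    have hab : Commute a b := Commute.cfcAbs_left (VonNeumannAlgebra.commute_of_mem x.2 hb)
      (VonNeumannAlgebra.commute_of_mem x.2 (star_mem hb))
    exact hab.add_left
      ((((Commute.one_left b).sub_left (hab.pow_left 2)).cfcₙ_nnreal _).smul_left _)
  have hstar : star U = a - Complex.I • CFC.sqrt (1 - a ^ 2) := by
    have hs : star (CFC.sqrt (1 - a ^ 2)) = CFC.sqrt (1 - a ^ 2) :=
      (CFC.sqrt_nonneg (1 - a ^ 2)).isSelfAdjoint.star_eq
    rw [hUdef, star_add, star_smul, hsa.star_eq, hs]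
    simp [sub_eq_add_neg]
  -- A unitary right factor preserves isometry on `1 - e` and coisometry on `e`.
  have key : ∀ V (hV : V ∈ M), V ∈ unitary (H →L[ℂ] H) →
      IsCStarExtremePoint (⟨w * V, mul_mem hwM hV⟩ : M) := by
    intro V hV hVu
    refine isCStarExtremePoint_of_central (sub_mem (one_mem M) heM) he.one_sub hec ?_ ?_ ?_
    · have h₁ := hec (star V) (star_mem hV)
      have h₂ := Unitary.star_mul_self_of_mem hVu
      have h₃ := hec V hV
      simp only [star_mul]
      linear_combination (norm := noncomm_ring) h₁ * (star w * w * V) + star V * hzw * V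
        + star V * h₃ + h₂ * (1 - e)
    · have h₂ := Unitary.mul_star_self_of_mem hVu
      simp only [star_mul]
      linear_combination (norm := noncomm_ring) (1 - (1 - e)) * w * h₂ * star w + hzw'
    · refine (norm_mul_le _ _).trans ?_
      refine mul_le_one₀ (hw.norm_le_one_of_star_mul_self rfl) (norm_nonneg _) ?_
      rw [norm_le_one_iff_star_mul_self_le_one, Unitary.star_mul_self_of_mem hVu]
  refine ⟨_, _, key U hUM hU, key (star U) (star_mem hUM) (Unitary.star_mem hU), ?_⟩
  change (x : H →L[ℂ] H) = (1 / 2 : ℂ) • (w * U + w * star U)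
  rw [← mul_add, hstar, hUdef, add_add_sub_cancel, mul_add, hwx, ← two_smul ℂ, smul_smul]
  norm_num
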